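/- For a real number $\xi$ let $\|\xi\|$ denote the distance from $\xi$ to the nearest integer. Let $f\in\mathbb{R}[x]$ be a real polynomial of degree $d\ge 1$. Then the set $$\Big\{\alpha\in\mathbb{R}:\ \liminf_{n\to\infty}\, n\log n\,\|\alpha f(n)\|>0\Big\}$$ (where $n$ runs through the natural numbers and the lower limit is allowed to be $+\infty$) has Hausdorff dimension strictly greater than $\frac{d}{d+1}$; in particular it is nonempty. Moreover, W. Schmidt's question whether $\liminf_{n\to\infty} n\log n\,\|\alpha n^2\|=0$ holds for every real $\alpha$ has a negative answer: there is a real $\alpha$ for which this lower limit is not $0$. -/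

import Mathlib

open Filter Polynomial
open scoped ENNReal

/-- The distance `‖ξ‖` from a real number `ξ` to the nearest integer. -/
noncomputable def distNearestInt (ξ : ℝ) : ℝ := |ξ - (round ξ : ℝ)|

/-- `liminf_{n → ∞} n log n ‖α t_n‖` along the natural numbers. It is taken in the extended
reals because it can be `+∞`. -/
noncomputable def liminfNLogN (t : ℕ → ℝ) (α : ℝ) : EReal :=
  liminf (fun n : ℕ => (((n : ℝ) * Real.log n * distNearestInt (α * t n) : ℝ) : EReal)) atTop

/-- The set of all real `α` with `liminf_{n → ∞} n log n ‖α f(n)‖ > 0`. -/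
def positiveLiminfSet (f : ℝ[X]) : Set ℝ :=
  {α : ℝ | 0 < liminfNLogN (fun n : ℕ => f.eval (n : ℝ)) α}

/-!
The proof is the method of Peres and Schlag. Choose scales `h₀ < h₁ < …` with `hᵢ₊₁ = hᵢ ^ m` and
intervals of length `ℓᵢ ∼ 1 / hᵢ`. For a suitable `p`, the `x` in an interval of length `ℓᵢ` with
`‖x f(n)‖ < c / (n log n)` for some `hᵢ ^ p < n ≤ hᵢ₊₁ ^ p` make up a proportion `O(c)` of it,
because the sum of `1 / (n log n)` over this range of `n` is at most `m`. If `m` is large compared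
with `p` and the degree of `f`, then at the scale `ℓᵢ₊₂` this exceptional set is a union of
intervals, up to doubling `c`. So for small `c` one can keep at least half of the subintervals at
each scale and avoid the exceptional set of every range. The Cantor set that remains has dimension
`1`: the loss of a factor `2` at each of `i` scales is negligible against any power of `1 / ℓᵢ`,
which grows doubly exponentially.
-/

open Set MeasureTheory Topology
open scoped NNReal

/-! ### Lower bounds for the Hausdorff dimension -/

theorem mul_dimH_le_dimH_image {X Y : Type*} [EMetricSpace X] [EMetricSpace Y] {f : X → Y}
    {s : Set X} {C r : ℝ≥0}
    (hf : ∀ x ∈ s, ∀ y ∈ s, edist x y ≤ C * edist (f x) (f y) ^ (r : ℝ)) :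
    r * dimH s ≤ dimH (f '' s) := by
  rcases eq_or_ne r 0 with rfl | hr
  · simp
  rcases isEmpty_or_nonempty X with hX | hX
  · simp [eq_empty_of_isEmpty s]
  have hr0 : 0 < r := pos_iff_ne_zero.2 hr
  have hinj : InjOn f s := fun x hx y hy hxy => by
    simpa [hxy, hr0] using hf x hx y hy
  set g := Function.invFunOn f s
  have hgf : LeftInvOn g f s := hinj.leftInvOn_invFunOn
  have hg : HolderOnWith C r g (f '' s) := by
    rintro _ ⟨x, hx, rfl⟩ _ ⟨y, hy, rfl⟩
    simpa only [hgf hx, hgf hy] using hf x hx y hy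
  have hdim := hg.dimH_image_le hr0
  rw [hgf.image_image] at hdim
  exact ENNReal.mul_le_of_le_div' hdim

/-- The number of intervals at level `i` of a tree whose intervals at level `j` have `K j`
children each. -/
def levelCard (K : ℕ → ℕ) (i : ℕ) : ℕ := ∏ j ∈ Finset.range i, K j

/-- A tree of closed intervals, as in the construction of a Cantor set. The intervals at level `i`
have length `ℓ i`, do not overlap and are numbered from left to right by `q < levelCard K i`;
each has `K i` children, so that the parent of interval `q` at level `i + 1` is `q / K i`. Outside
the range `q < levelCard K i` the endpoint `left i q` has no meaning. -/
structure IntervalTree (ℓ : ℕ → ℝ) (K : ℕ → ℕ) where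
  left : ℕ → ℕ → ℝ
  length_pos : ∀ i, 0 < ℓ i
  branching_pos : ∀ i, 0 < K i
  add_length_le_left : ∀ {i q q'}, q < q' → q' < levelCard K i → left i q + ℓ i ≤ left i q'
  interval_subset_parent : ∀ {i q}, q < levelCard K (i + 1) →
    Icc (left (i + 1) q) (left (i + 1) q + ℓ (i + 1)) ⊆
      Icc (left i (q / K i)) (left i (q / K i) + ℓ i)

namespace IntervalTree

variable {ℓ : ℕ → ℝ} {K : ℕ → ℕ}

theorem div_lt_levelCard {i q : ℕ} (hq : q < levelCard K (i + 1)) : q / K i < levelCard K i := by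
  rw [levelCard, Finset.prod_range_succ] at hq
  exact Nat.div_lt_of_lt_mul (mul_comm (levelCard K i) _ ▸ hq)

section Construction

variable (K) in
/-- The left endpoints of the intervals of a tree with root `u₀`, in which the interval at level
`i` with left endpoint `u` has the children with left endpoints `c i u 0, c i u 1, …`. -/
def leftEndpoint (u₀ : ℝ) (c : ℕ → ℝ → ℕ → ℝ) : ℕ → ℕ → ℝ
  | 0, _ => u₀
  | i + 1, q => c i (leftEndpoint u₀ c i (q / K i)) (q % K i)

variable {A : ℕ → Set ℝ} {u₀ : ℝ} {c : ℕ → ℝ → ℕ → ℝ}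

theorem leftEndpoint_mem (hK : ∀ i, 0 < K i) (h₀ : u₀ ∈ A 0)
    (hc : ∀ i, ∀ u ∈ A i, ∀ q < K i, c i u q ∈ A (i + 1)) :
    ∀ {i q}, q < levelCard K i → leftEndpoint K u₀ c i q ∈ A i
  | 0, _, _ => h₀
  | i + 1, _, hq =>
    hc i _ (leftEndpoint_mem hK h₀ hc (div_lt_levelCard hq)) _ (Nat.mod_lt _ (hK i))

theorem exists_of_forall_children (hℓ : ∀ i, 0 < ℓ i) (hK : ∀ i, 0 < K i) (h₀ : u₀ ∈ A 0)
    (hstep : ∀ i, ∀ u ∈ A i, ∃ c : ℕ → ℝ,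
      (∀ p q, p < q → q < K i → c p + ℓ (i + 1) ≤ c q) ∧
      ∀ q < K i, c q ∈ A (i + 1) ∧ Icc (c q) (c q + ℓ (i + 1)) ⊆ Icc u (u + ℓ i)) :
    ∃ τ : IntervalTree ℓ K, ∀ i, ∀ q < levelCard K i, τ.left i q ∈ A i := by
  choose! c hgap hchild using hstep
  have hmem {i q : ℕ} (hq : q < levelCard K i) : leftEndpoint K u₀ c i q ∈ A i :=
    leftEndpoint_mem hK h₀ (fun i u hu q hq => (hchild i u hu q hq).1) hq
  have hsub {i q : ℕ} (hq : q < levelCard K (i + 1)) :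
      Icc (leftEndpoint K u₀ c (i + 1) q) (leftEndpoint K u₀ c (i + 1) q + ℓ (i + 1)) ⊆
        Icc (leftEndpoint K u₀ c i (q / K i)) (leftEndpoint K u₀ c i (q / K i) + ℓ i) :=
    (hchild i _ (hmem (div_lt_levelCard hq)) _ (Nat.mod_lt _ (hK i))).2
  refine ⟨⟨leftEndpoint K u₀ c, hℓ, hK, fun {i} => ?_, hsub⟩, fun _ _ => hmem⟩
  induction i with
  | zero => simp only [levelCard, Finset.range_zero, Finset.prod_empty]; omega
  | succ i ih =>
    intro q q' hqq' hq'
    rcases (Nat.div_le_div_right (c := K i) hqq'.le).lt_or_eq with hlt | heq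
    · have hparents := ih hlt (div_lt_levelCard hq')
      have hq_le := ((Icc_subset_Icc_iff (by linarith [hℓ (i + 1)])).1 (hsub (hqq'.trans hq'))).2
      have hle_q' := ((Icc_subset_Icc_iff (by linarith [hℓ (i + 1)])).1 (hsub hq')).1
      linarith
    · have hmod : q % K i < q' % K i := by
        have hq := Nat.div_add_mod q (K i)
        have hq' := Nat.div_add_mod q' (K i)
        rw [heq] at hq
        omega
      simp only [leftEndpoint, heq]
      exact hgap i _ (hmem (div_lt_levelCard hq')) _ _ hmod (Nat.mod_lt _ (hK i))

end Construction

variable (τ : IntervalTree ℓ K)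

/-- The Cantor set of a tree: the points that lie in an interval of every level. -/
def limitSet : Set ℝ :=
  {x | ∀ i, ∃ q < levelCard K i, x ∈ Icc (τ.left i q) (τ.left i q + ℓ i)}

variable (K) in
/-- The index at level `i` of the interval that corresponds to `y ∈ [0, 1)`, when `[0, 1)` is cut
into `levelCard K i` equal parts. -/
noncomputable def address (i : ℕ) (y : ℝ) : ℕ := ⌊y * levelCard K i⌋₊

/-- The point of the Cantor set that corresponds to `y ∈ [0, 1)`. -/
noncomputable def point (y : ℝ) : ℝ := ⨆ i, τ.left i (address K i y)

include τ in
theorem levelCard_pos (i : ℕ) : 0 < levelCard K i := Finset.prod_pos fun j _ => τ.branching_pos j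

include τ in
theorem address_lt_levelCard {y : ℝ} (hy : y ∈ Ico (0 : ℝ) 1) (i : ℕ) :
    address K i y < levelCard K i := by
  have hcard : (0 : ℝ) < levelCard K i := by exact_mod_cast τ.levelCard_pos i
  exact (Nat.floor_lt (mul_nonneg hy.1 hcard.le)).2 (mul_lt_of_lt_one_left hcard hy.2)

include τ in
theorem address_succ_div (i : ℕ) (y : ℝ) : address K (i + 1) y / K i = address K i y := by
  have hK : (K i : ℝ) ≠ 0 := by exact_mod_cast (τ.branching_pos i).ne'
  rw [address, ← Nat.floor_div_natCast, address, levelCard, levelCard, Finset.prod_range_succ,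
    Nat.cast_mul, ← mul_assoc, mul_div_cancel_right₀ _ hK]

theorem point_mem_interval {y : ℝ} (hy : y ∈ Ico (0 : ℝ) 1) (i : ℕ) :
    τ.point y ∈ Icc (τ.left i (address K i y)) (τ.left i (address K i y) + ℓ i) := by
  have hnest : Antitone fun i =>
      Icc (τ.left i (address K i y)) (τ.left i (address K i y) + ℓ i) :=
    antitone_nat_of_succ_le fun i => by
      simpa only [τ.address_succ_div] using
        τ.interval_subset_parent (τ.address_lt_levelCard hy (i + 1))
  exact mem_iInter.1 (ciSup_mem_iInter_Icc_of_antitone_Icc hnest fun j =>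
    le_add_of_nonneg_right (τ.length_pos j).le) i

theorem point_mem_limitSet {y : ℝ} (hy : y ∈ Ico (0 : ℝ) 1) : τ.point y ∈ τ.limitSet :=
  fun i => ⟨_, τ.address_lt_levelCard hy i, τ.point_mem_interval hy i⟩

theorem left_add_mul_length_le {i q n : ℕ} (h : q + n < levelCard K i) :
    τ.left i q + n * ℓ i ≤ τ.left i (q + n) := by
  induction n with
  | zero => simp
  | succ n ih =>
    have hlast := τ.add_length_le_left (show q + n < q + (n + 1) by omega) h
    push_cast
    linarith [ih (by omega)]

theorem sub_mul_le_point_sub_point {y y' : ℝ} (hy : y ∈ Ico (0 : ℝ) 1) (hy' : y' ∈ Ico (0 : ℝ) 1)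
    (hle : y ≤ y') (i : ℕ) :
    (y' - y) * (levelCard K i * ℓ i) ≤ τ.point y' - τ.point y + 2 * ℓ i := by
  obtain ⟨n, hn⟩ : ∃ n, address K i y' = address K i y + n :=
    Nat.exists_eq_add_of_le (Nat.floor_le_floor (by gcongr))
  have hseparation := τ.left_add_mul_length_le (hn ▸ τ.address_lt_levelCard hy' i)
  rw [← hn] at hseparation
  have hn_ge : (y' - y) * levelCard K i - 1 ≤ n := by
    have hfloor : (address K i y : ℝ) ≤ y * levelCard K i :=
      Nat.floor_le (mul_nonneg hy.1 (Nat.cast_nonneg _))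
    have hfloor' : y' * levelCard K i < address K i y' + 1 := Nat.lt_floor_add_one _
    have hn' : (address K i y' : ℝ) = address K i y + n := by exact_mod_cast hn
    linarith
  have hmul := mul_le_mul_of_nonneg_right hn_ge (τ.length_pos i).le
  linarith [(τ.point_mem_interval hy i).2, (τ.point_mem_interval hy' i).1]

variable {s : ℝ≥0} {C : ℝ}

include τ in
/-- A distance `ρ` is compared with the level `i` for which `ℓ (i + 1) < ρ ≤ ℓ i`. -/
theorem le_mul_rpow_of_forall_level (hs : s ≤ 1) (hlim : Tendsto ℓ atTop (𝓝 0))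
    (hC : ∀ i, ℓ i ^ (1 - s : ℝ) ≤ C * (levelCard K (i + 1) * ℓ (i + 1))) {r ρ : ℝ}
    (hρ : ρ ∈ Ioc 0 (ℓ 0)) (h : ∀ i, r * (levelCard K i * ℓ i) ≤ ρ + 2 * ℓ i) :
    r ≤ 3 * C * ρ ^ (s : ℝ) := by
  obtain ⟨i, hle, hlt⟩ : ∃ i, ¬ ℓ i < ρ ∧ ℓ (i + 1) < ρ :=
    Nat.exists_not_and_succ_of_not_zero_of_exists hρ.2.not_gt
      (hlim.eventually_lt_const hρ.1).exists
  have hP : 0 < levelCard K (i + 1) * ℓ (i + 1) :=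
    mul_pos (Nat.cast_pos.2 (τ.levelCard_pos _)) (τ.length_pos _)
  have hρs : ρ ^ (1 - s : ℝ) ≤ C * (levelCard K (i + 1) * ℓ (i + 1)) :=
    (Real.rpow_le_rpow hρ.1.le (not_lt.1 hle) (sub_nonneg.2 hs)).trans (hC i)
  refine le_of_mul_le_mul_right ?_ hP
  calc r * (levelCard K (i + 1) * ℓ (i + 1)) ≤ ρ + 2 * ℓ (i + 1) := h (i + 1)
    _ ≤ 3 * (ρ ^ (1 - s : ℝ) * ρ ^ (s : ℝ)) := by
      rw [← Real.rpow_add hρ.1, sub_add_cancel, Real.rpow_one]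
      linarith
    _ ≤ 3 * (C * (levelCard K (i + 1) * ℓ (i + 1)) * ρ ^ (s : ℝ)) := by
      gcongr
      exact Real.rpow_nonneg hρ.1.le _
    _ = 3 * C * ρ ^ (s : ℝ) * (levelCard K (i + 1) * ℓ (i + 1)) := by ring

theorem sub_le_mul_point_sub_point_rpow (hs₀ : 0 < s) (hs : s ≤ 1) (hlim : Tendsto ℓ atTop (𝓝 0))
    (hC : ∀ i, ℓ i ^ (1 - s : ℝ) ≤ C * (levelCard K (i + 1) * ℓ (i + 1))) {y y' : ℝ}
    (hy : y ∈ Ico (0 : ℝ) 1) (hy' : y' ∈ Ico (0 : ℝ) 1) (hle : y ≤ y') :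
    y' - y ≤ 3 * C * |τ.point y' - τ.point y| ^ (s : ℝ) := by
  have hlevel := τ.sub_mul_le_point_sub_point hy hy' hle
  have hmono : 0 ≤ τ.point y' - τ.point y := by
    refine ge_of_tendsto' (by simpa using (hlim.const_mul 2).const_add _) fun i => ?_
    have := τ.length_pos i
    exact le_trans (mul_nonneg (sub_nonneg.2 hle) (by positivity)) (hlevel i)
  have hdiam : τ.point y' - τ.point y ≤ ℓ 0 := by
    have haddress {z : ℝ} (hz : z ∈ Ico (0 : ℝ) 1) : address K 0 z = 0 :=
      Nat.lt_one_iff.1 (τ.address_lt_levelCard hz 0)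
    have h := τ.point_mem_interval hy 0
    have h' := τ.point_mem_interval hy' 0
    rw [haddress hy] at h
    rw [haddress hy'] at h'
    linarith [h.1, h'.2]
  rw [abs_of_nonneg hmono]
  rcases hmono.eq_or_lt with hzero | hpos
  · -- All `ρ > 0` are admissible in `le_mul_rpow_of_forall_level`; let `ρ → 0`.
    rw [← hzero] at hlevel ⊢
    have hs₀' : 0 < (s : ℝ) := hs₀
    have hlim₀ : Tendsto (fun ρ : ℝ => 3 * C * ρ ^ (s : ℝ)) (𝓝[>] 0) (𝓝 (3 * C * 0 ^ (s : ℝ))) :=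
      (((Real.continuous_rpow_const hs₀'.le).tendsto 0).const_mul _).mono_left nhdsWithin_le_nhds
    refine ge_of_tendsto hlim₀ ?_
    filter_upwards [Ioc_mem_nhdsGT (τ.length_pos 0)] with ρ hρ
    exact τ.le_mul_rpow_of_forall_level hs hlim hC hρ fun i => by linarith [hlevel i, hρ.1]
  · exact τ.le_mul_rpow_of_forall_level hs hlim hC ⟨hpos, hdiam⟩ hlevel

theorem le_dimH_limitSet (hs : s ≤ 1) (hlim : Tendsto ℓ atTop (𝓝 0))
    (hC : ∀ i, ℓ i ^ (1 - s : ℝ) ≤ C * (levelCard K (i + 1) * ℓ (i + 1))) :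
    (s : ℝ≥0∞) ≤ dimH τ.limitSet := by
  rcases eq_or_ne s 0 with rfl | hs₀
  · simp
  have hholder : ∀ y ∈ Ico (0 : ℝ) 1, ∀ y' ∈ Ico (0 : ℝ) 1,
      dist y y' ≤ 3 * C * dist (τ.point y) (τ.point y') ^ (s : ℝ) := by
    intro y hy y' hy'
    wlog hle : y ≤ y' generalizing y y'
    · simpa only [dist_comm] using this y' hy' y hy (not_le.1 hle).le
    · rw [dist_comm y, dist_comm (τ.point y), Real.dist_eq, Real.dist_eq,
        abs_of_nonneg (sub_nonneg.2 hle)]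
      exact τ.sub_le_mul_point_sub_point_rpow (pos_iff_ne_zero.2 hs₀) hs hlim hC hy hy' hle
  have hdim : dimH (Ico (0 : ℝ) 1) = 1 := by
    simpa using Real.dimH_of_nonempty_interior (E := ℝ) (s := Ico (0 : ℝ) 1) (by simp)
  calc (s : ℝ≥0∞) = s * dimH (Ico (0 : ℝ) 1) := by rw [hdim, mul_one]
    _ ≤ dimH (τ.point '' Ico 0 1) := by
      refine mul_dimH_le_dimH_image (C := (3 * C).toNNReal) fun y hy y' hy' => ?_
      change _ ≤ ENNReal.ofReal (3 * C) * _
      rw [edist_dist, edist_dist, ENNReal.ofReal_rpow_of_nonneg dist_nonneg s.coe_nonneg,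
        ← ENNReal.ofReal_mul' (by positivity)]
      exact ENNReal.ofReal_le_ofReal (hholder y hy y' hy')
    _ ≤ dimH τ.limitSet := dimH_mono (image_subset_iff.2 fun y hy => τ.point_mem_limitSet hy)

end IntervalTree

/-! ### The Peres–Schlag argument -/

theorem card_mul_le_measure {α ι : Type*} [MeasurableSpace α] {μ : Measure α} {T : Finset ι}
    {s : ι → Set α} {S : Set α} {c : ℝ≥0∞} (hd : (T : Set ι).PairwiseDisjoint s)
    (hm : ∀ i ∈ T, MeasurableSet (s i)) (hS : ∀ i ∈ T, s i ⊆ S) (hc : ∀ i ∈ T, c ≤ μ (s i)) :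
    T.card * c ≤ μ S := by
  calc T.card * c ≤ ∑ i ∈ T, μ (s i) := by
        simpa only [nsmul_eq_mul] using Finset.card_nsmul_le_sum T _ c hc
    _ = μ (⋃ i ∈ T, s i) := (measure_biUnion_finset hd hm).symm
    _ ≤ μ S := measure_mono (iUnion₂_subset hS)

theorem pairwise_disjoint_Ico_add_mul (u : ℝ) {ℓ : ℝ} (hℓ : 0 ≤ ℓ) :
    Pairwise (Function.onFun Disjoint fun q : ℕ => Ico (u + q * ℓ) (u + q * ℓ + ℓ)) := by
  have hmono : Monotone fun q : ℕ => u + q * ℓ := fun p q hpq => by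
    have : (p : ℝ) ≤ q := Nat.cast_le.2 hpq
    dsimp only
    gcongr
  simpa only [Nat.succ_eq_succ, Nat.succ_eq_add_one, Nat.cast_add, Nat.cast_one, add_mul, one_mul,
    ← add_assoc] using hmono.pairwise_disjoint_on_Ico_succ

section Subintervals

variable {u ℓ : ℝ}

theorem add_mul_add_le {M q : ℕ} (hℓ : 0 ≤ ℓ) (hq : q < M) : u + q * ℓ + ℓ ≤ u + M * ℓ := by
  have hq' : (q : ℝ) + 1 ≤ M := by exact_mod_cast hq
  linarith [mul_le_mul_of_nonneg_right hq' hℓ]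

theorem card_mul_le_of_volume_Ico_inter_le {F : Set ℝ} {a b : ℝ} {M : ℕ} {T : Finset ℕ}
    (hℓ : 0 < ℓ) (ha : 0 ≤ a) (hT : T ⊆ Finset.range M)
    (hF : volume (Ico u (u + M * ℓ) ∩ F) ≤ ENNReal.ofReal (a * (M * ℓ)))
    (hq : ∀ q ∈ T, ENNReal.ofReal (b * ℓ) ≤ volume (Ico (u + q * ℓ) (u + q * ℓ + ℓ) ∩ F)) :
    T.card * b ≤ a * M := by
  have hcard : T.card * ENNReal.ofReal (b * ℓ) ≤ ENNReal.ofReal (a * (M * ℓ)) := by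
    refine le_trans ?_ hF
    rw [← Measure.restrict_apply measurableSet_Ico]
    refine card_mul_le_measure ((pairwise_disjoint_Ico_add_mul u hℓ.le).set_pairwise _)
      (fun _ _ => measurableSet_Ico) (fun q hqT => Ico_subset_Ico ?_ ?_) fun q hqT => ?_
    · exact le_add_of_nonneg_right (by positivity)
    · exact add_mul_add_le hℓ.le (Finset.mem_range.1 (hT hqT))
    · rw [Measure.restrict_apply measurableSet_Ico]
      exact hq q hqT
  rw [← ENNReal.ofReal_natCast, ← ENNReal.ofReal_mul (Nat.cast_nonneg _),
    ENNReal.ofReal_le_ofReal_iff (by positivity), ← mul_assoc, ← mul_assoc] at hcard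
  exact le_of_mul_le_mul_right hcard hℓ

/-- At most a quarter of the `2 * K` subintervals meet `E`, because such a subinterval is
contained in `F`, and at most another quarter have too large an intersection with `F'`. -/
theorem exists_half_subintervals_disjoint {E F F' : Set ℝ} {K : ℕ} (hℓ : 0 < ℓ)
    (hEF : ∀ v, (Icc v (v + ℓ) ∩ E).Nonempty → Icc v (v + ℓ) ⊆ F)
    (hF : volume (Ico u (u + (2 * K : ℕ) * ℓ) ∩ F) ≤ ENNReal.ofReal (1 / 4 * ((2 * K : ℕ) * ℓ)))
    (hF' : volume (Ico u (u + (2 * K : ℕ) * ℓ) ∩ F') ≤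
      ENNReal.ofReal (1 / 16 * ((2 * K : ℕ) * ℓ))) :
    ∃ T ⊆ Finset.range (2 * K), K ≤ T.card ∧ ∀ q ∈ T,
      Disjoint (Icc (u + q * ℓ) (u + q * ℓ + ℓ)) E ∧
      volume (Ico (u + q * ℓ) (u + q * ℓ + ℓ) ∩ F') ≤ ENNReal.ofReal (1 / 4 * ℓ) := by
  classical
  let meets := (Finset.range (2 * K)).filter fun q : ℕ =>
    (Icc (u + q * ℓ) (u + q * ℓ + ℓ) ∩ E).Nonempty
  let heavy := (Finset.range (2 * K)).filter fun q : ℕ =>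
    ENNReal.ofReal (1 / 4 * ℓ) < volume (Ico (u + q * ℓ) (u + q * ℓ + ℓ) ∩ F')
  have hmeets : meets.card * (1 : ℝ) ≤ 1 / 4 * (2 * K : ℕ) := by
    refine card_mul_le_of_volume_Ico_inter_le hℓ (by norm_num) (Finset.filter_subset _ _) hF
      fun q hq => ?_
    have hsub := Ico_subset_Icc_self.trans (hEF _ (Finset.mem_filter.1 hq).2)
    rw [inter_eq_left.2 hsub, Real.volume_Ico, add_sub_cancel_left, one_mul]
  have hheavy : heavy.card * (1 / 4 : ℝ) ≤ 1 / 16 * (2 * K : ℕ) :=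
    card_mul_le_of_volume_Ico_inter_le hℓ (by norm_num) (Finset.filter_subset _ _) hF'
      fun q hq => (Finset.mem_filter.1 hq).2.le
  refine ⟨Finset.range (2 * K) \ (meets ∪ heavy), Finset.sdiff_subset, ?_, fun q hq => ?_⟩
  · have hunion : (meets ∪ heavy).card ≤ K := by
      refine (Finset.card_union_le _ _).trans ?_
      push_cast at hmeets hheavy
      have : (meets.card : ℝ) + heavy.card ≤ K := by linarith
      exact_mod_cast this
    have hsdiff := Finset.le_card_sdiff (meets ∪ heavy) (Finset.range (2 * K))
    rw [Finset.card_range] at hsdiff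
    omega
  · simp only [meets, heavy, Finset.mem_sdiff, Finset.mem_union, Finset.mem_filter, not_or,
      not_and, not_lt, not_nonempty_iff_eq_empty] at hq
    obtain ⟨hqM, hqE, hqF'⟩ := hq
    exact ⟨disjoint_iff_inter_eq_empty.2 (hqE hqM), hqF' hqM⟩

theorem exists_separated_children {K : ℕ} {T : Finset ℕ} (hℓ : 0 ≤ ℓ)
    (hT : T ⊆ Finset.range (2 * K)) (hcard : K ≤ T.card) :
    ∃ c : ℕ → ℝ, (∀ p q, p < q → q < K → c p + ℓ ≤ c q) ∧
      ∀ q < K, (∃ k ∈ T, c q = u + k * ℓ) ∧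
        Icc (c q) (c q + ℓ) ⊆ Icc u (u + (2 * K : ℕ) * ℓ) := by
  have hfin : {q | q ∈ T}.Finite := T.finite_toSet
  have hfin_card : hfin.toFinset.card = T.card := congrArg _ T.finite_toSet_toFinset
  have hmem (q : ℕ) (hq : q < K) : Nat.nth (· ∈ T) q ∈ T :=
    Nat.nth_mem (p := (· ∈ T)) q fun _ => (hq.trans_le hcard).trans_eq hfin_card.symm
  refine ⟨fun q => u + Nat.nth (· ∈ T) q * ℓ, fun p q hpq hq => ?_, fun q hq =>
    ⟨⟨_, hmem q hq, rfl⟩, Icc_subset_Icc ?_ ?_⟩⟩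
  · exact add_mul_add_le hℓ
      (Nat.nth_lt_nth_of_lt_card hfin hpq (hq.trans_le (hcard.trans_eq hfin_card.symm)))
  · exact le_add_of_nonneg_right (by positivity)
  · exact add_mul_add_le hℓ (Finset.mem_range.1 (hT (hmem q hq)))

end Subintervals

section PeresSchlag

variable {ℓ : ℕ → ℝ} {K : ℕ → ℕ}

theorem levelCard_mul_eq_div_two_pow (hℓ : ∀ i, ℓ i = (2 * K i : ℕ) * ℓ (i + 1)) (i : ℕ) :
    levelCard K i * ℓ i = ℓ 0 / 2 ^ i := by
  induction i with
  | zero => simp [levelCard]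
  | succ i ih =>
    rw [pow_succ, ← div_div, ← ih, hℓ i, levelCard, levelCard, Finset.prod_range_succ]
    push_cast
    ring

theorem tendsto_zero_of_eq_two_mul (hpos : ∀ i, 0 < ℓ i) (hK : ∀ i, 0 < K i)
    (hℓ : ∀ i, ℓ i = (2 * K i : ℕ) * ℓ (i + 1)) : Tendsto ℓ atTop (𝓝 0) := by
  have hhalf (i : ℕ) : ℓ (i + 1) ≤ 1 / 2 * ℓ i := by
    have hK' : (1 : ℝ) ≤ K i := by exact_mod_cast hK i
    have := hℓ i
    push_cast at this
    nlinarith [hpos (i + 1)]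
  have hgeom (i : ℕ) : ℓ i ≤ (1 / 2) ^ i * ℓ 0 := by
    simpa using le_geom (by norm_num) i fun k _ => hhalf k
  refine squeeze_zero (fun i => (hpos i).le) hgeom ?_
  simpa using (tendsto_pow_atTop_nhds_zero_of_lt_one (r := (1 / 2 : ℝ))
    (by norm_num) (by norm_num)).mul_const (ℓ 0)

/-- Intervals are selected so that `F i` occupies at most a quarter of each interval at level `i`.
One level down this allows to discard all the intervals that meet `E i`, while the intervals that
contain too much of `F (i + 1)` are few by averaging. -/
theorem le_dimH_setOf_forall_notMem {E F : ℕ → Set ℝ} {u₀ C : ℝ} {s : ℝ≥0} (hs : s ≤ 1)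
    (hpos : ∀ i, 0 < ℓ i) (hK : ∀ i, 0 < K i) (hℓ : ∀ i, ℓ i = (2 * K i : ℕ) * ℓ (i + 1))
    (hC : ∀ i, 2 ^ i * ℓ i ^ (1 - s : ℝ) ≤ C)
    (hEF : ∀ i v, (Icc v (v + ℓ (i + 1)) ∩ E i).Nonempty → Icc v (v + ℓ (i + 1)) ⊆ F i)
    (hF₀ : volume (Ico u₀ (u₀ + ℓ 0) ∩ F 0) ≤ ENNReal.ofReal (1 / 4 * ℓ 0))
    (hF : ∀ i v, volume (Ico v (v + ℓ i) ∩ F (i + 1)) ≤ ENNReal.ofReal (1 / 16 * ℓ i)) :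
    (s : ℝ≥0∞) ≤ dimH {x | ∀ i, x ∉ E i} := by
  let A (i : ℕ) : Set ℝ := {u | volume (Ico u (u + ℓ i) ∩ F i) ≤ ENNReal.ofReal (1 / 4 * ℓ i) ∧
    ∀ k < i, Disjoint (Icc u (u + ℓ i)) (E k)}
  obtain ⟨τ, hτ⟩ : ∃ τ : IntervalTree ℓ K, ∀ i, ∀ q < levelCard K i, τ.left i q ∈ A i := by
    refine IntervalTree.exists_of_forall_children hpos hK (u₀ := u₀) ⟨hF₀, by simp⟩ ?_
    rintro i u ⟨hu, hdisj⟩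
    have hF' := hF i u
    rw [hℓ i] at hu hF' hdisj ⊢
    obtain ⟨T, hT, hcard, hgood⟩ :=
      exists_half_subintervals_disjoint (hpos (i + 1)) (hEF i) hu hF'
    obtain ⟨c, hgap, hchild⟩ := exists_separated_children (u := u) (hpos (i + 1)).le hT hcard
    refine ⟨c, hgap, fun q hq => ⟨?_, (hchild q hq).2⟩⟩
    obtain ⟨⟨k, hk, hck⟩, hsub⟩ := hchild q hq
    obtain ⟨hE, hvol⟩ := hck ▸ hgood k hk
    refine ⟨hvol, fun j hj => ?_⟩
    rcases Nat.lt_succ_iff_lt_or_eq.1 hj with hlt | rfl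
    · exact (hdisj j hlt).mono_left hsub
    · exact hE
  have hlimitSet : τ.limitSet ⊆ {x | ∀ i, x ∉ E i} := fun x hx i => by
    obtain ⟨q, hq, hxq⟩ := hx (i + 1)
    exact disjoint_left.1 ((hτ _ q hq).2 i i.lt_succ_self) hxq
  refine (τ.le_dimH_limitSet (C := 2 * C / ℓ 0) hs (tendsto_zero_of_eq_two_mul hpos hK hℓ)
    fun i => ?_).trans (dimH_mono hlimitSet)
  have hℓ₀ := (hpos 0).ne'
  rw [levelCard_mul_eq_div_two_pow hℓ, pow_succ]
  calc ℓ i ^ (1 - s : ℝ) ≤ C / 2 ^ i := (le_div_iff₀' (by positivity)).2 (hC i)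
    _ = 2 * C / ℓ 0 * (ℓ 0 / (2 ^ i * 2)) := by field_simp

end PeresSchlag

/-! ### Reals close to an integer after multiplication -/

theorem distNearestInt_le_add_abs_sub (x y : ℝ) :
    distNearestInt y ≤ distNearestInt x + |y - x| := by
  calc distNearestInt y ≤ |y - round x| := round_le y _
    _ ≤ |y - x| + |x - round x| := abs_sub_le _ _ _
    _ = distNearestInt x + |y - x| := add_comm _ _

/-- The set of all `x` for which `‖x t‖ < η`. -/
def nearIntSet (t η : ℝ) : Set ℝ := {x | distNearestInt (x * t) < η}

theorem Icc_subset_nearIntSet_two_mul {t η u ℓ : ℝ} (htℓ : |t| * ℓ ≤ η)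
    (h : (Icc u (u + ℓ) ∩ nearIntSet t η).Nonempty) :
    Icc u (u + ℓ) ⊆ nearIntSet t (2 * η) := by
  obtain ⟨x, hx, hxη : distNearestInt (x * t) < η⟩ := h
  intro y hy
  have hxy : |y * t - x * t| ≤ η := by
    rw [← sub_mul, abs_mul, mul_comm]
    refine le_trans (mul_le_mul_of_nonneg_left ?_ (abs_nonneg t)) htℓ
    rw [abs_le]
    constructor <;> linarith [hx.1, hx.2, hy.1, hy.2]
  have := distNearestInt_le_add_abs_sub (x * t) (y * t)
  change distNearestInt (y * t) < 2 * η
  linarith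

theorem Ico_inter_nearIntSet_subset {t η u ℓ : ℝ} (ht : t ≠ 0) :
    Ico u (u + ℓ) ∩ nearIntSet t η ⊆
      ⋃ k ∈ Finset.Icc ⌈(u + ℓ / 2) * t - (|t| * ℓ / 2 + η)⌉ ⌊(u + ℓ / 2) * t + (|t| * ℓ / 2 + η)⌋,
        Metric.ball ((k : ℝ) / t) (η / |t|) := by
  rintro x ⟨hx, hxη : distNearestInt (x * t) < η⟩
  have hxmid : |(x - (u + ℓ / 2)) * t| ≤ |t| * ℓ / 2 := by
    rw [abs_mul, mul_comm, mul_div_assoc]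
    refine mul_le_mul_of_nonneg_left (abs_le.2 ?_) (abs_nonneg t)
    constructor <;> linarith [hx.1, hx.2]
  rw [distNearestInt, abs_lt] at hxη
  rw [abs_le] at hxmid
  simp only [mem_iUnion, Finset.mem_Icc, Int.ceil_le, Int.le_floor]
  refine ⟨round (x * t), ⟨by linarith, by linarith⟩, ?_⟩
  rw [Metric.mem_ball, Real.dist_eq, lt_div_iff₀ (abs_pos.2 ht), ← abs_mul, sub_mul,
    div_mul_cancel₀ _ ht]
  exact abs_lt.2 hxη

theorem volume_Ico_inter_nearIntSet_le {t η u ℓ : ℝ} (htℓ : 1 ≤ |t| * ℓ) :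
    volume (Ico u (u + ℓ) ∩ nearIntSet t η) ≤ ENNReal.ofReal (6 * η * ℓ) := by
  have ht : 0 < |t| := abs_pos.2 (by rintro rfl; norm_num at htℓ)
  have hℓ : 0 < ℓ := pos_of_mul_pos_right (zero_lt_one.trans_le htℓ) ht.le
  rcases lt_or_ge (1 / 2) η with hη | hη
  · refine (measure_mono inter_subset_left).trans ?_
    rw [Real.volume_Ico, add_sub_cancel_left]
    exact ENNReal.ofReal_le_ofReal (by nlinarith)
  · refine (measure_mono (Ico_inter_nearIntSet_subset (abs_pos.1 ht))).trans
      ((measure_biUnion_finset_le _ _).trans ?_)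
    simp only [Real.volume_ball, Finset.sum_const, Int.card_Icc, nsmul_eq_mul]
    have hcard (v : ℝ) : ((⌊v + (|t| * ℓ / 2 + η)⌋ + 1 - ⌈v - (|t| * ℓ / 2 + η)⌉).toNat : ℝ) ≤
        3 * (|t| * ℓ) := by
      rw [← Int.cast_natCast, Int.toNat_eq_max, Int.cast_max]
      push_cast
      refine max_le ?_ (by positivity)
      linarith [Int.floor_le (v + (|t| * ℓ / 2 + η)), Int.le_ceil (v - (|t| * ℓ / 2 + η))]
    rw [← ENNReal.ofReal_natCast]
    calc _ ≤ ENNReal.ofReal (3 * (|t| * ℓ)) * ENNReal.ofReal (2 * (η / |t|)) := by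
          gcongr
          exact hcard _
      _ = ENNReal.ofReal (6 * η * ℓ) := by
          rw [← ENNReal.ofReal_mul (by positivity)]
          congr 1
          field_simp
          ring

theorem sum_Ioc_one_div_le_log_sub_log {N n : ℕ} (hN : 0 < N) (hn : N ≤ n) :
    ∑ j ∈ Finset.Ioc N n, 1 / (j : ℝ) ≤ Real.log n - Real.log N := by
  induction n, hn using Nat.le_induction with
  | base => simp
  | succ n hn ih =>
    have hn₀ : (0 : ℝ) < n := by exact_mod_cast hN.trans_le hn
    have hlog : 1 / ((n + 1 : ℕ) : ℝ) ≤ Real.log (n + 1 : ℕ) - Real.log n := by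
      rw [← Real.log_div (by positivity) hn₀.ne']
      refine le_trans (le_of_eq ?_) (Real.one_sub_inv_le_log_of_pos (by positivity))
      push_cast
      field_simp
      ring
    rw [Finset.sum_Ioc_succ_top (by omega)]
    linarith

theorem sum_Ioc_pow_one_div_mul_log_le {N m : ℕ} (hN : 2 ≤ N) (hm : m ≠ 0) :
    ∑ j ∈ Finset.Ioc N (N ^ m), 1 / ((j : ℝ) * Real.log j) ≤ m := by
  have hlogN : 0 < Real.log N := Real.log_pos (by exact_mod_cast hN)
  calc ∑ j ∈ Finset.Ioc N (N ^ m), 1 / ((j : ℝ) * Real.log j)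
      ≤ ∑ j ∈ Finset.Ioc N (N ^ m), 1 / (j : ℝ) * (Real.log N)⁻¹ := by
        refine Finset.sum_le_sum fun j hj => ?_
        have hNj : N < j := (Finset.mem_Ioc.1 hj).1
        have : (0 : ℝ) < N := by exact_mod_cast (by omega : 0 < N)
        rw [← div_div, div_eq_mul_inv _ (Real.log j)]
        gcongr
    _ ≤ (Real.log (N ^ m : ℕ) - Real.log N) * (Real.log N)⁻¹ := by
        rw [← Finset.sum_mul]
        gcongr
        exact sum_Ioc_one_div_le_log_sub_log (by omega) (Nat.le_self_pow hm N)
    _ = m - 1 := by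
        rw [Nat.cast_pow, Real.log_pow]
        field_simp
    _ ≤ m := by linarith

/-- The set of all `x` for which `‖x t_j‖ < c / (j log j)` for some `j` with `N < j ≤ n`. -/
def nearIntBlock (t : ℕ → ℝ) (c : ℝ) (N n : ℕ) : Set ℝ :=
  ⋃ j ∈ Finset.Ioc N n, nearIntSet (t j) (c / (j * Real.log j))

theorem Icc_subset_nearIntBlock_two_mul {t : ℕ → ℝ} {c u ℓ : ℝ} {N n : ℕ}
    (htℓ : ∀ j ∈ Finset.Ioc N n, |t j| * ℓ ≤ c / (j * Real.log j))
    (h : (Icc u (u + ℓ) ∩ nearIntBlock t c N n).Nonempty) :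
    Icc u (u + ℓ) ⊆ nearIntBlock t (2 * c) N n := by
  simp only [nearIntBlock, inter_iUnion, nonempty_iUnion] at h
  obtain ⟨j, hj, hmeet⟩ := h
  simp only [nearIntBlock, mul_div_assoc]
  exact subset_iUnion₂_of_subset j hj (Icc_subset_nearIntSet_two_mul (htℓ j hj) hmeet)

theorem volume_Ico_inter_nearIntBlock_le {t : ℕ → ℝ} {u ℓ c : ℝ} {N m : ℕ} (hN : 2 ≤ N)
    (hm : m ≠ 0) (hc : 0 ≤ c) (hℓ : 0 ≤ ℓ) (ht : ∀ j, N < j → 1 ≤ |t j| * ℓ) :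
    volume (Ico u (u + ℓ) ∩ nearIntBlock t c N (N ^ m)) ≤ ENNReal.ofReal (6 * c * m * ℓ) := by
  have hnonneg (j : ℕ) : 0 ≤ (j : ℝ) * Real.log j :=
    mul_nonneg j.cast_nonneg (Real.log_natCast_nonneg j)
  simp only [nearIntBlock, inter_iUnion]
  calc volume (⋃ j ∈ Finset.Ioc N (N ^ m),
        Ico u (u + ℓ) ∩ nearIntSet (t j) (c / (j * Real.log j)))
      ≤ ∑ j ∈ Finset.Ioc N (N ^ m), ENNReal.ofReal (6 * (c / (j * Real.log j)) * ℓ) :=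
        (measure_biUnion_finset_le _ _).trans <| Finset.sum_le_sum fun j hj =>
          volume_Ico_inter_nearIntSet_le (ht j (Finset.mem_Ioc.1 hj).1)
    _ = ENNReal.ofReal (∑ j ∈ Finset.Ioc N (N ^ m), 6 * (c / (j * Real.log j)) * ℓ) :=
        (ENNReal.ofReal_sum_of_nonneg fun j _ => by have := hnonneg j; positivity).symm
    _ = ENNReal.ofReal (6 * c * (∑ j ∈ Finset.Ioc N (N ^ m), 1 / (j * Real.log j)) * ℓ) := by
        rw [Finset.mul_sum, Finset.sum_mul]
        simp only [mul_one_div, mul_div_assoc]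
    _ ≤ ENNReal.ofReal (6 * c * m * ℓ) := by
        gcongr
        exact sum_Ioc_pow_one_div_mul_log_le hN hm

/-! ### Sequences of polynomial growth -/

theorem exists_forall_two_pow_mul_rpow_le {A ε : ℝ} (hA : 0 ≤ A) (hε : 0 < ε) {H m : ℕ}
    (hH : 2 ≤ H) (hm : 2 ≤ m) :
    ∃ C, ∀ i : ℕ, 2 ^ i * (A / (H ^ m ^ i : ℕ)) ^ ε ≤ C := by
  have hlog : 0 < Real.log H := Real.log_pos (by exact_mod_cast hH)
  have : (0 : ℝ) < H := by exact_mod_cast (by omega : 0 < H)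
  refine ⟨A ^ ε / (ε * Real.log H), fun i => ?_⟩
  have hexp : ε * Real.log H * 2 ^ i ≤ ((H ^ m ^ i : ℕ) : ℝ) ^ ε := by
    calc ε * Real.log H * 2 ^ i ≤ ε * Real.log H * m ^ i := by
          gcongr
          exact_mod_cast hm
      _ ≤ Real.exp (ε * Real.log H * m ^ i) := by
          linarith [Real.add_one_le_exp (ε * Real.log H * m ^ i)]
      _ = ((H ^ m ^ i : ℕ) : ℝ) ^ ε := by
          rw [Real.rpow_def_of_pos (by positivity), Nat.cast_pow, Real.log_pow]
          push_cast
          ring_nf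
  rw [Real.div_rpow hA (Nat.cast_nonneg _), le_div_iff₀ (by positivity), mul_div_left_comm,
    mul_assoc]
  refine mul_le_of_le_one_right (by positivity) ?_
  rw [div_mul_eq_mul_div, div_le_one (by positivity)]
  linarith

theorem abs_mul_div_pow_le {T A c : ℝ} {p b h j : ℕ} (hA : 0 ≤ A) (hj : 2 ≤ j) (hjh : j ≤ h ^ p)
    (hh : A ^ 2 ≤ c * h) (hT : |T| ≤ A * j ^ b) :
    |T| * (A / (h : ℝ) ^ (p * (b + 2) + 1)) ≤ c / (j * Real.log j) := by
  have hlog : 0 < Real.log j := Real.log_pos (by exact_mod_cast hj)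
  have : 0 < j := by omega
  have hh₀ : 0 ≤ c * h := (sq_nonneg A).trans hh
  have hpos : 0 < h := Nat.pos_of_ne_zero (by rintro rfl; linarith [zero_pow_le_one (M₀ := ℕ) p])
  have hjh' : (j : ℝ) ≤ h ^ p := by exact_mod_cast hjh
  rw [le_div_iff₀ (by positivity), mul_div_assoc', div_mul_eq_mul_div, div_le_iff₀ (by positivity)]
  calc |T| * A * (j * Real.log j) ≤ A * j ^ b * A * (j * j) := by
        gcongr
        exact Real.log_le_self j.cast_nonneg
    _ = A ^ 2 * (j : ℝ) ^ (b + 2) := by ring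
    _ ≤ c * h * ((h : ℝ) ^ p) ^ (b + 2) := by gcongr
    _ = c * (h : ℝ) ^ (p * (b + 2) + 1) := by ring

theorem one_le_abs_mul_div {T A : ℝ} {p h j : ℕ} (hA : 0 ≤ A) (hh : 0 < h) (hj : h ^ p < j)
    (hT : (j : ℝ) ≤ (A * |T|) ^ p) : 1 ≤ |T| * (A / h) := by
  have hlt : (h : ℝ) ^ p < (A * |T|) ^ p := lt_of_lt_of_le (by exact_mod_cast hj) hT
  rw [mul_div_assoc', one_le_div (by exact_mod_cast hh), mul_comm]
  exact (lt_of_pow_lt_pow_left₀ p (by positivity) hlt).le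

theorem eventually_le_distNearestInt_of_forall_notMem {t : ℕ → ℝ} {c x : ℝ} {N : ℕ → ℕ}
    (hN : Tendsto N atTop atTop) (hx : ∀ i, x ∉ nearIntBlock t c (N (i - 1)) (N i)) :
    ∀ᶠ n : ℕ in atTop, c / (n * Real.log n) ≤ distNearestInt (x * t n) := by
  filter_upwards [eventually_gt_atTop (N 0)] with n hn
  obtain ⟨i, hi, hi'⟩ : ∃ i, ¬ n ≤ N i ∧ n ≤ N (i + 1) :=
    Nat.exists_not_and_succ_of_not_zero_of_exists hn.not_ge (hN.eventually_ge_atTop n).exists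
  have hxn := hx (i + 1)
  simp only [nearIntBlock, mem_iUnion, not_exists] at hxn
  exact not_lt.1 (hxn n (Finset.mem_Ioc.2 ⟨not_le.1 hi, hi'⟩))

theorem exists_div_eq_two_mul_mul_div_pow {h m : ℕ} (A : ℝ) (hh : Even h) (hh₀ : 0 < h)
    (hm : 2 ≤ m) : ∃ K : ℕ, 0 < K ∧ A / h = (2 * K : ℕ) * (A / (h ^ m : ℕ)) := by
  obtain ⟨m, rfl⟩ := Nat.exists_eq_add_of_le hm
  obtain ⟨k, rfl⟩ := hh.two_dvd
  have hk : 0 < k := by omega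
  refine ⟨k * (2 * k) ^ m, by positivity, ?_⟩
  push_cast
  field_simp
  ring

theorem exists_scales {A ε : ℝ} (hA : 0 ≤ A) (hε : 0 < ε) {m : ℕ} (hm : 2 ≤ m) (R : ℕ) :
    ∃ h : ℕ → ℕ, (∀ i, R ≤ h i) ∧ (∀ i, Even (h i)) ∧ (∀ i, h (i + 1) = h i ^ m) ∧
      ∃ C, ∀ i, 2 ^ i * (A / h i) ^ ε ≤ C := by
  refine ⟨fun i => (2 * (R + 1)) ^ m ^ i, fun i => ?_, fun i => ?_, fun i => ?_,
    exists_forall_two_pow_mul_rpow_le hA hε (by omega) hm⟩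
  · exact le_trans (by omega) (Nat.le_self_pow (by positivity) (2 * (R + 1)))
  · exact (even_two_mul _).pow_of_ne_zero (by positivity)
  · simp only [pow_succ, pow_mul]

section Scales

variable {t : ℕ → ℝ} {A c : ℝ} {p b n₀ m h N : ℕ}

theorem Icc_subset_nearIntBlock_of_forall_abs_le (hA : 0 ≤ A)
    (hup : ∀ n ≥ n₀, |t n| ≤ A * (n : ℝ) ^ b) (hN : max 1 n₀ ≤ N) (hh : A ^ 2 ≤ c * h) {u : ℝ}
    (hmeets : (Icc u (u + A / (h ^ (p * (b + 2) + 1) : ℕ)) ∩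
      nearIntBlock t c N (h ^ p)).Nonempty) :
    Icc u (u + A / (h ^ (p * (b + 2) + 1) : ℕ)) ⊆ nearIntBlock t (2 * c) N (h ^ p) := by
  refine Icc_subset_nearIntBlock_two_mul (fun j hj => ?_) hmeets
  obtain ⟨hNj, hjh⟩ := Finset.mem_Ioc.1 hj
  rw [Nat.cast_pow]
  exact abs_mul_div_pow_le hA (by omega) hjh hh (hup j (by omega))

theorem volume_Ico_inter_nearIntBlock_pow_le (hA : 0 ≤ A)
    (hlow : ∀ n ≥ n₀, (n : ℝ) ≤ (A * |t n|) ^ p) (hp : p ≠ 0) (hm : m ≠ 0) (hc : 0 ≤ c)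
    (hh : max 2 n₀ ≤ h) (u : ℝ) :
    volume (Ico u (u + A / h) ∩ nearIntBlock t c (h ^ p) ((h ^ m) ^ p)) ≤
      ENNReal.ofReal (6 * c * m * (A / h)) := by
  have hhp : h ≤ h ^ p := Nat.le_self_pow hp h
  rw [pow_right_comm]
  exact volume_Ico_inter_nearIntBlock_le (by omega) hm hc (by positivity) fun j hj =>
    one_le_abs_mul_div hA (by omega) hj (hlow j (by omega))

/-- The scales are `ℓ i = A / h i`, and the `i`-th set to be avoided takes care of the `n` with
`h (i - 1) ^ p < n ≤ h i ^ p`; for `i = 0` there are none, because `0 - 1 = 0`. The bound on `c`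
says that `6 * (2 * c) * m ≤ 1 / 16`. -/
theorem le_dimH_setOf_eventually_le_distNearestInt (hA : 0 < A) (hp : p ≠ 0)
    (hlow : ∀ n ≥ n₀, (n : ℝ) ≤ (A * |t n|) ^ p) (hup : ∀ n ≥ n₀, |t n| ≤ A * (n : ℝ) ^ b)
    (hm : m = p * (b + 2) + 1) (hc : 0 < c) (hcm : 192 * c * m ≤ 1) {s : ℝ≥0} (hs : s < 1) :
    (s : ℝ≥0∞) ≤
      dimH {x | ∀ᶠ n : ℕ in atTop, c / (n * Real.log n) ≤ distNearestInt (x * t n)} := by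
  have hm₂ : 2 ≤ m := by have := Nat.pos_of_ne_zero hp; nlinarith
  obtain ⟨h, hR, heven, hsucc, C, hC⟩ :=
    exists_scales hA.le (sub_pos.2 hs : (0 : ℝ) < 1 - s) hm₂ (max 2 (max n₀ ⌈A ^ 2 / c⌉₊))
  simp only [max_le_iff, Nat.ceil_le, div_le_iff₀' hc] at hR
  have hpos (i : ℕ) : 0 < A / h i := div_pos hA (by exact_mod_cast zero_lt_two.trans_le (hR i).1)
  have hmono : StrictMono fun i => h i ^ p := strictMono_nat_of_lt_succ fun i =>
    Nat.pow_lt_pow_left (hsucc i ▸ lt_self_pow₀ (hR i).1 hm₂) hp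
  choose K hK hℓ using fun i =>
    exists_div_eq_two_mul_mul_div_pow A (heven i) (zero_lt_two.trans_le (hR i).1) hm₂
  simp only [← hsucc] at hℓ
  have hdiscard (i : ℕ) (u : ℝ) :
      (Icc u (u + A / h (i + 1)) ∩ nearIntBlock t c (h (i - 1) ^ p) (h i ^ p)).Nonempty →
      Icc u (u + A / h (i + 1)) ⊆ nearIntBlock t (2 * c) (h (i - 1) ^ p) (h i ^ p) := by
    have hN : h (i - 1) ≤ h (i - 1) ^ p := Nat.le_self_pow hp _
    rw [hsucc, hm]
    exact Icc_subset_nearIntBlock_of_forall_abs_le hA.le hup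
      (by have := hR (i - 1); omega) (hR i).2.2
  have hvolume (i : ℕ) (u : ℝ) :
      volume (Ico u (u + A / h i) ∩ nearIntBlock t (2 * c) (h i ^ p) (h (i + 1) ^ p)) ≤
        ENNReal.ofReal (1 / 16 * (A / h i)) := by
    rw [hsucc]
    refine (volume_Ico_inter_nearIntBlock_pow_le hA.le hlow hp (by omega) (by positivity)
      (max_le (hR i).1 (hR i).2.1) u).trans (ENNReal.ofReal_le_ofReal ?_)
    exact mul_le_mul_of_nonneg_right (by linarith) (hpos i).le
  have hdim := le_dimH_setOf_forall_notMem (u₀ := 0) hs.le hpos hK hℓ hC hdiscard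
    (by simp [nearIntBlock]) hvolume
  refine hdim.trans (dimH_mono fun x hx => ?_)
  exact eventually_le_distNearestInt_of_forall_notMem hmono.tendsto_atTop hx

end Scales

/-! ### The dimension of the exceptional set -/

theorem exists_nat_growth_bounds {t : ℕ → ℝ} {a b : ℝ} (ha : 0 < a)
    (hlow : (fun n : ℕ => (n : ℝ) ^ a) =O[atTop] t)
    (hup : t =O[atTop] fun n : ℕ => (n : ℝ) ^ b) :
    ∃ A : ℝ, 0 < A ∧ ∃ p ≠ 0, ∃ β n₀ : ℕ, ∀ n ≥ n₀,
      (n : ℝ) ≤ (A * |t n|) ^ p ∧ |t n| ≤ A * (n : ℝ) ^ β := by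
  obtain ⟨A₁, hA₁, h₁⟩ := hlow.exists_pos
  obtain ⟨A₂, hA₂, h₂⟩ := hup.exists_pos
  obtain ⟨p, hp⟩ := exists_nat_ge (1 / a)
  have hp₀ : p ≠ 0 := by
    rintro rfl
    exact (one_div_pos.2 ha).not_ge (by exact_mod_cast hp)
  obtain ⟨n₀, hn₀⟩ := eventually_atTop.1 ((h₁.bound.and h₂.bound).and (eventually_ge_atTop 1))
  refine ⟨A₁ + A₂, by positivity, p, hp₀, ⌈b⌉₊, n₀, fun n hn => ?_⟩
  obtain ⟨⟨hn₁, hn₂⟩, hn₃⟩ := hn₀ n hn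
  have hn₃' : (1 : ℝ) ≤ n := by exact_mod_cast hn₃
  simp only [Real.norm_eq_abs, abs_of_nonneg (Real.rpow_nonneg n.cast_nonneg _)] at hn₁ hn₂
  constructor
  · calc (n : ℝ) = (n : ℝ) ^ (1 : ℝ) := (Real.rpow_one _).symm
      _ ≤ (n : ℝ) ^ (a * p) :=
        Real.rpow_le_rpow_of_exponent_le hn₃' ((div_le_iff₀' ha).1 hp)
      _ = ((n : ℝ) ^ a) ^ p := Real.rpow_mul_natCast n.cast_nonneg a p
      _ ≤ ((A₁ + A₂) * |t n|) ^ p := by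
        gcongr
        exact hn₁.trans (by gcongr; linarith)
  · calc |t n| ≤ A₂ * (n : ℝ) ^ b := hn₂
      _ ≤ (A₁ + A₂) * (n : ℝ) ^ (⌈b⌉₊ : ℝ) := by
        gcongr
        · linarith
        · exact Nat.le_ceil b
      _ = (A₁ + A₂) * (n : ℝ) ^ ⌈b⌉₊ := by rw [Real.rpow_natCast]

theorem liminfNLogN_pos_of_eventually_le {t : ℕ → ℝ} {c x : ℝ} (hc : 0 < c)
    (h : ∀ᶠ n : ℕ in atTop, c / (n * Real.log n) ≤ distNearestInt (x * t n)) :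
    0 < liminfNLogN t x := by
  refine (EReal.coe_pos.2 hc).trans_le (le_liminf_of_le (by isBoundedDefault) ?_)
  filter_upwards [h, eventually_gt_atTop 1] with n hn hn₁
  have hlog : 0 < Real.log n := Real.log_pos (by exact_mod_cast hn₁)
  have : (0 : ℝ) < n := by exact_mod_cast zero_lt_one.trans hn₁
  exact EReal.coe_le_coe_iff.2 ((div_le_iff₀' (by positivity)).1 hn)

theorem mainTheorem2_general {t : ℕ → ℝ} {a b : ℝ} (ha : 0 < a)
    (hlow : (fun n : ℕ => (n : ℝ) ^ a) =O[atTop] t)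
    (hup : t =O[atTop] fun n : ℕ => (n : ℝ) ^ b) :
    dimH {α : ℝ | 0 < liminfNLogN t α} = 1 := by
  obtain ⟨A, hA, p, hp, β, n₀, hbounds⟩ := exists_nat_growth_bounds ha hlow hup
  refine le_antisymm ((dimH_mono (subset_univ _)).trans_eq Real.dimH_univ)
    (ENNReal.le_of_forall_nnreal_lt fun s hs => ?_)
  have hc : (0 : ℝ) < 1 / (192 * (p * (β + 2) + 1 : ℕ)) := by positivity
  have hdim := le_dimH_setOf_eventually_le_distNearestInt hA hp (fun n hn => (hbounds n hn).1)
    (fun n hn => (hbounds n hn).2) rfl hc (by field_simp; rfl) (by exact_mod_cast hs)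
  exact hdim.trans (dimH_mono fun x hx => liminfNLogN_pos_of_eventually_le hc hx)

theorem dimH_positiveLiminfSet {f : ℝ[X]} (hf : f.natDegree ≠ 0) :
    dimH (positiveLiminfSet f) = 1 := by
  have hlead : f.leadingCoeff ≠ 0 := leadingCoeff_ne_zero.2 (by rintro rfl; simp at hf)
  have htheta : (fun x : ℝ => f.eval x) =Θ[atTop] fun x : ℝ => x ^ (f.natDegree : ℝ) := by
    simpa only [Real.rpow_natCast] using f.isEquivalent_atTop_lead.isTheta.trans
      ((Asymptotics.isTheta_const_mul_left hlead).2 (Asymptotics.isTheta_refl _ _))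
  exact mainTheorem2_general (Nat.cast_pos.2 (Nat.pos_of_ne_zero hf))
    (htheta.2.comp_tendsto tendsto_natCast_atTop_atTop)
    (htheta.1.comp_tendsto tendsto_natCast_atTop_atTop)

theorem mainTheorem2 :
    (∀ (f : ℝ[X]) (d : ℕ), 1 ≤ d → f.natDegree = d →
      (d : ℝ≥0∞) / ((d : ℝ≥0∞) + 1) < dimH (positiveLiminfSet f) ∧
      (positiveLiminfSet f).Nonempty) ∧
    ¬ (∀ α : ℝ, liminfNLogN (fun n : ℕ => (n : ℝ) ^ 2) α = 0) := by
  have hnonempty {f : ℝ[X]} (hf : f.natDegree ≠ 0) : (positiveLiminfSet f).Nonempty := by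
    by_contra h
    simpa [not_nonempty_iff_eq_empty.1 h] using dimH_positiveLiminfSet hf
  refine ⟨fun f d hd hfd => ?_, fun h => ?_⟩
  · have hf : f.natDegree ≠ 0 := by omega
    refine ⟨?_, hnonempty hf⟩
    rw [dimH_positiveLiminfSet hf, ENNReal.div_lt_iff (by simp) (by simp), one_mul]
    exact_mod_cast d.lt_succ_self
  · obtain ⟨α, hα⟩ := hnonempty (f := X ^ 2) (by simp)
    have hpos : 0 < liminfNLogN (fun n : ℕ => (n : ℝ) ^ 2) α := by
      simpa [positiveLiminfSet] using hα
    exact hpos.ne' (h α)
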